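/- Let $k\ge 1$ and let $\Lambda$ be a nonempty, finite (i.e. $\Lambda^n=d^{-1}(n)$ is finite for every $n\in\mathbb N^k$), strongly connected (i.e. $v\Lambda w\neq\emptyset$ for all $v,w\in\Lambda^0$) $k$-graph, with adjacency matrices $A_i(v,w)=\#(v\Lambda^{e_i}w)$, $1\le i\le k$. Let $\rho_i$ be the spectral radius of $A_i$, and let $x^\Lambda\in(0,\infty)^{\Lambda^0}$ be the Perron–Frobenius eigenvector of $\Lambda$, i.e. the unique positive vector with $\sum_v x^\Lambda_v=1$ and $A_ix^\Lambda=\rho_ix^\Lambda$ for all $i$. Let $\mathcal B_\Lambda$ be the stationary $k$-Bratteli diagram of $A_1,\dots,A_k$: each vertex set $\mathcal V_n$ ($n\ge 0$) is a copy of $\Lambda^0$, and for $n\ge 1$ with $n\equiv i \pmod k$ there are $A_i(p,q)$ edges with range $p\in\mathcal V_{n-1}$ and source $q\in\mathcal V_n$. Let $X_{\mathcal B_\Lambda}$ be its space of infinite paths $x=(x_n)_{n\ge1}$ (where $x_n$ is an edge from $\mathcal V_n$ to $\mathcal V_{n-1}$ and $s(x_n)=r(x_{n+1})$), and let $F\mathcal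 B_\Lambda$ be the set of its finite paths with range in $\mathcal V_0$, including the vertices of $\mathcal V_0$ as paths of length $0$. For $\eta\in F\mathcal B_\Lambda$ let $[\eta]\subseteq X_{\mathcal B_\Lambda}$ be the set of infinite paths with initial segment $\eta$. Fix $\delta\in(0,1)$. For $\eta\in F\mathcal B_\Lambda$ of length $qk+t$ with $q,t\in\mathbb N$, $0\le t\le k-1$, put $$w_\delta(\eta)=\left(\rho_1^{q+1}\cdots\rho_t^{q+1}\,\rho_{t+1}^{q}\cdots\rho_k^{q}\right)^{-1/\delta}x^\Lambda_{s(\eta)},$$ and for $x,y\in X_{\mathcal B_\Lambda}$ put $d_\delta(x,y)=0$ if $x=y$, $d_\delta(x,y)=1$ if $r(x)\ne r(y)$, and otherwise $d_\delta(x,y)=w_\delta(x\wedge y)$, where $x\wedge y\in F\mathcal B_\Lambda$ is the longest common initial segment of $x$ and $y$. Suppose that $$w_\delta(\lambda)=\operatorname{diam}[\lambda]=\sup\{d_\delta(x,y): x,y\in[\lambda]\}\qquad\text{for all }\lambda\in F\mathcal B_\Lambda .$$ Then $d_\delta$ is a metric on $X_{\mathcal B_\Lambda}$ satisfying the strong triangle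 inequality, and the $\delta$-dimensional Hausdorff measure $H^\delta$ of $(X_{\mathcal B_\Lambda},d_\delta)$ satisfies $$0<H^\delta(X_{\mathcal B_\Lambda})<\infty .$$ -/

import Mathlib

open CategoryTheory MeasureTheory

universe u v

/-! ### Higher-rank graphs

A morphism `f : w ⟶ v` has source `s(f) = w` and range `r(f) = v`; the composite written `μν` in the
arrows-only notation (first `ν`, then `μ`) is `ν ≫ μ`. -/

/-- A `k`-graph structure on a category `Λ`: countability, the degree functor to `ℕ^k`, and the
factorization property.  The objects of `Λ` are the vertices. -/
class KGraph (k : ℕ) (Λ : Type u) [Category.{v} Λ] where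
  countable_obj : Countable Λ
  countable_hom : ∀ w v : Λ, Countable (w ⟶ v)
  degree : ∀ {w v : Λ}, (w ⟶ v) → (Fin k → ℕ)
  degree_id : ∀ v : Λ, degree (𝟙 v) = 0
  degree_comp : ∀ {u w v : Λ} (ν : u ⟶ w) (μ : w ⟶ v), degree (ν ≫ μ) = degree μ + degree ν
  factorization : ∀ {w v : Λ} (f : w ⟶ v) (m n : Fin k → ℕ), degree f = m + n →
    ∃! p : (Σ z : Λ, (w ⟶ z) × (z ⟶ v)),
      degree p.2.2 = m ∧ degree p.2.1 = n ∧ p.2.1 ≫ p.2.2 = f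

namespace KGraph

variable (k : ℕ) (Λ : Type u) [Category.{v} Λ] [KGraph k Λ]

/-- `v Λ^n w`: the morphisms of degree `n` with range `v` and source `w`. -/
def Between {k : ℕ} {Λ : Type u} [Category.{v} Λ] [KGraph k Λ] (v : Λ) (n : Fin k → ℕ) (w : Λ) :
    Type v :=
  {f : w ⟶ v // degree f = n}

/-- `Λ` is finite: `Λ^n` is finite for every `n ∈ ℕ^k`. -/
def IsFinite : Prop :=
  ∀ n : Fin k → ℕ, Finite (Σ v w : Λ, Between v n w)

/-- `Λ` is strongly connected: `vΛw ≠ ∅` for all vertices `v`, `w`. -/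
def StronglyConnected (Λ : Type u) [Category.{v} Λ] : Prop :=
  ∀ v w : Λ, Nonempty (w ⟶ v)

/-- The adjacency matrices `A_i(v, w) = #(v Λ^{e_i} w)`. -/
noncomputable def adjacency (i : Fin k) : Matrix Λ Λ ℕ :=
  Matrix.of fun v w => Nat.card (Between v (Pi.single i 1 : Fin k → ℕ) w)

variable [Fintype Λ] [DecidableEq Λ]

/-- `ρ_i`, the spectral radius of `A_i` (as a complex matrix). -/
noncomputable def rho (i : Fin k) : ℝ :=
  (spectralRadius ℂ ((adjacency k Λ i).map (Nat.cast : ℕ → ℂ))).toReal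

/-- `x` is a positive vector with coordinate sum `1` and `A_i x = ρ_i x` for all `i`. -/
def IsPerronFrobenius (x : Λ → ℝ) : Prop :=
  (∀ v, 0 < x v) ∧ ∑ v, x v = 1 ∧
    ∀ i : Fin k, ((adjacency k Λ i).map (Nat.cast : ℕ → ℝ)).mulVec x = rho k Λ i • x

/-- The Perron–Frobenius eigenvector `x^Λ`.  It exists and is unique when `Λ` is finite, strongly
connected and nonempty. -/
noncomputable def perronFrobenius : Λ → ℝ :=
  Classical.epsilon (IsPerronFrobenius k Λ)

end KGraph

/-! ### Bratteli diagrams -/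

/-- A Bratteli diagram.  `V n` is the `n`-th vertex set `𝒱_n` for `n ≥ 0`, and `E n` is the edge set
`ℰ_{n+1}`, whose edges have source in `𝒱_{n+1}` and range in `𝒱_n`. -/
structure BratteliDiagram where
  V : ℕ → Type u
  E : ℕ → Type u
  r : ∀ {n}, E n → V n
  s : ∀ {n}, E n → V (n + 1)
  finite_V : ∀ n, Finite (V n)
  finite_E : ∀ n, Finite (E n)

namespace BratteliDiagram

variable (B : BratteliDiagram.{u})

/-- The infinite path space `X_B`. -/
def InfPath : Type u :=
  {x : ∀ n, B.E n // ∀ n, B.s (x n) = B.r (x (n + 1))}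

/-- Finite paths of length `n` with range in `𝒱_0`, recorded by the vertices they visit and their
edges (a path of length `0` is a vertex of `𝒱_0`). -/
structure FinPath (n : ℕ) where
  vert : ∀ i : Fin (n + 1), B.V i
  edge : ∀ i : Fin n, B.E i
  range_edge : ∀ i : Fin n, B.r (edge i) = vert i.castSucc
  source_edge : ∀ i : Fin n, B.s (edge i) = vert i.succ

variable {B}

/-- The source `s(γ)` of a finite path. -/
def FinPath.source {n : ℕ} (γ : B.FinPath n) : B.V n :=
  γ.vert (Fin.last n)

/-- The range `r(x) ∈ 𝒱_0` of an infinite path. -/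
def InfPath.range (x : B.InfPath) : B.V 0 :=
  B.r (x.1 0)

/-- The initial segment of length `n` of an infinite path. -/
def InfPath.take (x : B.InfPath) (n : ℕ) : B.FinPath n where
  vert i := B.r (x.1 i)
  edge i := x.1 i
  range_edge _ := rfl
  source_edge i := x.2 i

/-- The cylinder set `[γ]`. -/
def FinPath.cylinder {n : ℕ} (γ : B.FinPath n) : Set B.InfPath :=
  {x | x.range = γ.vert 0 ∧ ∀ i : Fin n, x.1 i = γ.edge i}

open Classical in
/-- The function `d_w` attached to a function `w` on finite paths: `1` if `x`, `y` have no common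
initial path (not even the vertex of length `0`), `0` if `x = y`, and `w (x ∧ y)` otherwise, where
`x ∧ y` is the longest common initial path; its length is the first index where `x`, `y` differ. -/
noncomputable def pathDist (w : ∀ n, B.FinPath n → ℝ) (x y : B.InfPath) : ℝ :=
  if x.range ≠ y.range then 1
  else if x = y then 0
  else w (PiNat.firstDiff x.1 y.1) (x.take (PiNat.firstDiff x.1 y.1))

/-- `w(γ) = diam [γ] = sup {d_w(x, y) : x, y ∈ [γ]}` for every finite path `γ`. -/
def WeightEqDiam (w : ∀ n, B.FinPath n → ℝ) : Prop :=
  ∀ (n : ℕ) (γ : B.FinPath n),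
    IsLUB {t : ℝ | ∃ x ∈ γ.cylinder, ∃ y ∈ γ.cylinder, t = pathDist w x y} (w n γ)

/-- The stationary `k`-Bratteli diagram of matrices `A_1, …, A_k` (indexed by `Fin k`, i.e. from `0`):
every `𝒱_n` is a copy of `N`, and `ℰ_{n+1}` has `A_{(n mod k)}(p, q)` edges with range `p` and
source `q`. -/
def stationary {k : ℕ} [NeZero k] {N : Type u} [Finite N] (A : Fin k → Matrix N N ℕ) :
    BratteliDiagram.{u} where
  V _ := N
  E n := Σ p q : N, Fin (A (Fin.ofNat k n) p q)
  r e := e.1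
  s e := e.2.1
  finite_V _ := inferInstance
  finite_E n := by
    have (p : N) : Finite (Σ q : N, Fin (A (Fin.ofNat k n) p q)) := Finite.instSigma
    exact Finite.instSigma

end BratteliDiagram

namespace KGraph

variable (k : ℕ) [NeZero k] (Λ : Type u) [Category.{v} Λ] [KGraph k Λ] [Fintype Λ] [DecidableEq Λ]

/-- The stationary `k`-Bratteli diagram `B_Λ` of the adjacency matrices of `Λ`. -/
noncomputable def bratteli : BratteliDiagram.{u} :=
  BratteliDiagram.stationary (adjacency k Λ)

/-- For `|η| = n = qk + t` with `0 ≤ t < k`,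
`w_δ(η) = (ρ_1^{q+1} ⋯ ρ_t^{q+1} ρ_{t+1}^q ⋯ ρ_k^q)^{-1/δ} x^Λ_{s(η)}`. -/
noncomputable def weight (δ : ℝ) (n : ℕ) (η : (bratteli k Λ).FinPath n) : ℝ :=
  (∏ i : Fin k, rho k Λ i ^ (if (i : ℕ) < n % k then n / k + 1 else n / k)) ^ (-(1 / δ)) *
    perronFrobenius k Λ η.source

end KGraph

/-! Give the cylinder of a path of length `n` with source `v` the mass `x_v / rhoProd n`. By the
eigenvector equations the mass of a cylinder is the sum of the masses of its one-edge extensions,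
and the total mass is `1` (`isMass_weight`, `sum_transversal`). The `δ`-th power of the weight is
`x_v ^ δ / rhoProd n`, and `x_v` lies between a positive minimum and `1`, so mass and `diam ^ δ` of
cylinders are comparable. Covering by cylinders of one level bounds `H^δ` from above
(`hausdorffMeasure_lt_top`); the mass distribution principle bounds it from below by `1`
(`one_le_hausdorffMeasure`). No measure is constructed: compactness reduces the lower bound to
finite sums over one representative per cylinder.

Both bounds need cylinders with small diameter. Weights are positive and equal to diameters, so
every cylinder has two points, which forces the product of the `ρ_i` to exceed `1`
(`eventually_coeff_lt_one`). The same hypothesis makes weights decrease along paths, whence the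
ultrametric. The common eigenvector exists because the adjacency matrices commute with a strictly
positive matrix (`exists_isPerronFrobenius`). -/

namespace Matrix

/-! ### Perron theory of positive matrices -/

variable {N : Type u} [Fintype N]

/-- A strictly positive matrix maps nonzero nonnegative vectors to positive vectors. -/
theorem mulVec_pos_of_pos {T : Matrix N N ℝ} (hT : ∀ v w, 0 < T v w) {y : N → ℝ}
    (hy : ∀ v, 0 ≤ y v) (hy0 : y ≠ 0) (v : N) : 0 < T.mulVec y v := by
  obtain ⟨w, hw⟩ := Function.ne_iff.1 hy0
  exact Finset.sum_pos' (fun w _ => mul_nonneg (hT v w).le (hy w))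
    ⟨w, Finset.mem_univ w, mul_pos (hT v w) (lt_of_le_of_ne (hy w) (Ne.symm hw))⟩

/-- Perron's theorem: a strictly positive matrix has a positive eigenvector. -/
theorem exists_pos_eigenvector_of_pos [Nonempty N] {T : Matrix N N ℝ} (hT : ∀ v w, 0 < T v w) :
    ∃ (t : ℝ) (x : N → ℝ), (∀ v, 0 < x v) ∧ ∑ v, x v = 1 ∧ T.mulVec x = t • x := by
  classical
  set C : ℝ := ∑ v, ∑ w, T v w with hC
  have hsum : ∀ x ∈ stdSimplex ℝ N, ∑ v, T.mulVec x v ≤ C := by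
    intro x hx
    refine Finset.sum_le_sum fun v _ => Finset.sum_le_sum fun w _ => ?_
    exact mul_le_of_le_one_right (hT v w).le
      (hx.2 ▸ Finset.single_le_sum (fun i _ => hx.1 i) (Finset.mem_univ w))
  -- Collatz–Wielandt: the eigenvalue is the largest `t` with `t • x ≤ T x` for some `x` in the
  -- simplex.
  set K : Set (ℝ × (N → ℝ)) :=
    (Set.Icc 0 C ×ˢ stdSimplex ℝ N) ∩ {p | p.1 • p.2 ≤ T.mulVec p.2} with hK
  have hKc : IsCompact K := by
    refine (isCompact_Icc.prod (isCompact_stdSimplex ℝ N)).inter_right ?_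
    exact isClosed_le (by fun_prop)
      ((LinearMap.continuous_of_finiteDimensional T.mulVecLin).comp continuous_snd)
  have hKn : K.Nonempty := by
    obtain ⟨v⟩ := ‹Nonempty N›
    refine ⟨(0, Pi.single v 1), ⟨⟨⟨le_rfl, ?_⟩, single_mem_stdSimplex ℝ v⟩, ?_⟩⟩
    · exact Finset.sum_nonneg fun v _ => Finset.sum_nonneg fun w _ => (hT v w).le
    · intro w
      have h := single_mem_stdSimplex ℝ v
      simpa using (hT w v).le
  obtain ⟨⟨t, x⟩, ⟨⟨ht, hx⟩, htx⟩, hmax⟩ := hKc.exists_isMaxOn hKn continuous_fst.continuousOn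
  simp only at ht hx
  replace htx : t • x ≤ T.mulVec x := htx
  have hx0 : x ≠ 0 := by
    rintro rfl
    simpa using hx.2
  have hTx := mulVec_pos_of_pos hT hx.1 hx0
  have heig : T.mulVec x = t • x := by
    by_contra hne
    -- Applying `T` makes the nonzero slack positive everywhere, so the normalised `T x` admits a
    -- larger `t'`.
    have hz := mulVec_pos_of_pos hT (y := T.mulVec x - t • x) (fun v => sub_nonneg.2 (htx v))
      (sub_ne_zero.2 hne)
    have hz' : ∀ v, t * T.mulVec x v < T.mulVec (T.mulVec x) v := by
      intro v
      have := hz v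
      rw [mulVec_sub, mulVec_smul] at this
      simpa using this
    have hs : 0 < ∑ v, T.mulVec x v := Finset.sum_pos (fun v _ => hTx v) Finset.univ_nonempty
    obtain ⟨v₀, -, hv₀⟩ := Finset.exists_min_image Finset.univ
      (fun v => T.mulVec (T.mulVec x) v / T.mulVec x v) Finset.univ_nonempty
    set t' := T.mulVec (T.mulVec x) v₀ / T.mulVec x v₀
    have htt' : t < t' := (lt_div_iff₀ (hTx v₀)).2 (hz' v₀)
    set y : N → ℝ := (∑ v, T.mulVec x v)⁻¹ • T.mulVec x with hy
    have hyS : y ∈ stdSimplex ℝ N := by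
      refine ⟨fun v => mul_nonneg (inv_nonneg.2 hs.le) (hTx v).le, ?_⟩
      simp only [hy, Pi.smul_apply, smul_eq_mul, ← Finset.mul_sum]
      exact inv_mul_cancel₀ hs.ne'
    have hy' : t' • y ≤ T.mulVec y := by
      intro v
      have := (le_div_iff₀ (hTx v)).1 (hv₀ v (Finset.mem_univ v))
      rw [hy, mulVec_smul]
      simp only [Pi.smul_apply, smul_eq_mul]
      rw [mul_left_comm]
      exact mul_le_mul_of_nonneg_left this (inv_nonneg.2 hs.le)
    have ht'C : t' ≤ C := by
      refine le_trans ?_ (hsum y hyS)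
      calc t' = ∑ v, (t' • y) v := by
            simp only [Pi.smul_apply, smul_eq_mul, ← Finset.mul_sum, hyS.2, mul_one]
        _ ≤ _ := Finset.sum_le_sum fun v _ => hy' v
    have := hmax (show (t', y) ∈ K from ⟨⟨⟨ht.1.trans htt'.le, ht'C⟩, hyS⟩, hy'⟩)
    exact absurd htt' (not_lt.2 this)
  refine ⟨t, x, fun v => ?_, hx.2, heig⟩
  have h := hTx v
  rw [heig] at h
  exact lt_of_le_of_ne (hx.1 v) fun h0 => by simp [← h0] at h

/-- The eigenspace of a strictly positive matrix spanned by a positive eigenvector is a line. -/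
theorem exists_smul_eq_of_pos_eigenvector [Nonempty N] {T : Matrix N N ℝ} (hT : ∀ v w, 0 < T v w)
    {t : ℝ} {x y : N → ℝ} (hx : ∀ v, 0 < x v) (hTx : T.mulVec x = t • x)
    (hTy : T.mulVec y = t • y) : ∃ c : ℝ, y = c • x := by
  -- The minimal ratio is the largest `c` with `c • x ≤ y`. If `y - c • x` were nonzero, its image
  -- under `T` would be positive, yet this image vanishes at `v₀`.
  obtain ⟨v₀, -, hv₀⟩ := Finset.exists_min_image Finset.univ (fun v => y v / x v)
    Finset.univ_nonempty
  refine ⟨y v₀ / x v₀, ?_⟩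
  by_contra hne
  have h := mulVec_pos_of_pos hT (y := y - (y v₀ / x v₀) • x)
    (fun v => sub_nonneg.2 ((le_div_iff₀ (hx v)).1 (hv₀ v (Finset.mem_univ v))))
    (sub_ne_zero.2 hne) v₀
  rw [mulVec_sub, mulVec_smul, hTx, hTy] at h
  have := (hx v₀).ne'
  simp only [Pi.sub_apply, Pi.smul_apply, smul_eq_mul] at h
  have h2 : t * y v₀ - y v₀ / x v₀ * (t * x v₀) = 0 := by field_simp; ring
  linarith

/-- If a nonnegative matrix has a positive eigenvector, the eigenvalue is the spectral radius. -/
theorem toReal_spectralRadius_eq_of_pos_eigenvector [Nonempty N] [DecidableEq N]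
    {A : Matrix N N ℕ} {t : ℝ} {x : N → ℝ} (hx : ∀ v, 0 < x v)
    (hAx : (A.map (Nat.cast : ℕ → ℝ)).mulVec x = t • x) :
    (spectralRadius ℂ (A.map (Nat.cast : ℕ → ℂ))).toReal = t := by
  have hAx' : ∀ v, ∑ w, (A v w : ℝ) * x w = t * x v := fun v => congrFun hAx v
  have ht : 0 ≤ t := by
    obtain ⟨v⟩ := ‹Nonempty N›
    refine nonneg_of_mul_nonneg_left (b := x v) ?_ (hx v)
    rw [← hAx']
    exact Finset.sum_nonneg fun w _ => mul_nonneg (Nat.cast_nonneg _) (hx w).le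
  set M := A.map (Nat.cast : ℕ → ℂ)
  have key : spectralRadius ℂ M = ENNReal.ofReal t := by
    apply le_antisymm
    · refine iSup₂_le fun μ hμ => ?_
      rw [← Matrix.spectrum_toLin', ← Module.End.hasEigenvalue_iff_mem_spectrum] at hμ
      obtain ⟨y, hy⟩ := hμ.exists_hasEigenvector
      have hy0 := hy.2
      have hMy : ∀ v, ∑ w, (A v w : ℂ) * y w = μ * y v := fun v => congrFun hy.apply_eq_smul v
      -- With `c` the maximal ratio, `‖y‖ ≤ c x` with equality at `v₀`; row `v₀` of the eigenvalue
      -- equation then gives `‖μ‖ ≤ t`.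
      obtain ⟨v₀, -, hv₀⟩ := Finset.exists_max_image Finset.univ (fun v => ‖y v‖ / x v)
        Finset.univ_nonempty
      set c := ‖y v₀‖ / x v₀
      have hle : ∀ v, ‖y v‖ ≤ c * x v := fun v =>
        (div_le_iff₀ (hx v)).1 (hv₀ v (Finset.mem_univ v))
      have hc : ‖y v₀‖ = c * x v₀ := (div_mul_cancel₀ _ (hx v₀).ne').symm
      have hpos : 0 < ‖y v₀‖ := by
        obtain ⟨w, hw⟩ := Function.ne_iff.1 hy0
        have h1 : 0 < c * x w := lt_of_lt_of_le (norm_pos_iff.2 hw) (hle w)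
        rw [hc]
        exact mul_pos (pos_of_mul_pos_left h1 (hx w).le) (hx v₀)
      have : ‖μ‖ * ‖y v₀‖ ≤ t * ‖y v₀‖ := by
        calc ‖μ‖ * ‖y v₀‖ = ‖∑ w, (A v₀ w : ℂ) * y w‖ := by rw [hMy, norm_mul]
          _ ≤ ∑ w, ‖(A v₀ w : ℂ) * y w‖ := norm_sum_le _ _
          _ ≤ ∑ w, c * ((A v₀ w : ℝ) * x w) := by
            refine Finset.sum_le_sum fun w _ => ?_
            rw [norm_mul, Complex.norm_natCast, mul_left_comm]
            exact mul_le_mul_of_nonneg_left (hle w) (Nat.cast_nonneg _)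
          _ = t * ‖y v₀‖ := by rw [← Finset.mul_sum, hAx', hc]; ring
      have h2 := le_of_mul_le_mul_right this hpos
      rw [← enorm_eq_nnnorm, ← ofReal_norm]
      exact ENNReal.ofReal_le_ofReal h2
    · have hmem : (t : ℂ) ∈ spectrum ℂ M := by
        rw [← Matrix.spectrum_toLin', ← Module.End.hasEigenvalue_iff_mem_spectrum]
        refine Module.End.hasEigenvalue_of_hasEigenvector (x := fun v => (x v : ℂ)) ⟨?_, ?_⟩
        · rw [Module.End.mem_eigenspace_iff]
          funext v
          have := hAx' v
          simp only [Matrix.toLin'_apply, Pi.smul_apply, smul_eq_mul]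
          rw [← Complex.ofReal_mul, ← this]
          simp [M, Matrix.mulVec, dotProduct]
        · obtain ⟨v⟩ := ‹Nonempty N›
          intro h
          have := congrFun h v
          simp at this
          exact (hx v).ne' this
      refine le_trans (le_of_eq ?_) (le_iSup₂ (f := fun (z : ℂ) (_ : z ∈ spectrum ℂ M) =>
        (‖z‖₊ : ENNReal)) (t : ℂ) hmem)
      rw [← Real.enorm_of_nonneg ht]
      simp [enorm]
  rw [key, ENNReal.toReal_ofReal ht]

end Matrix

/-! ### The common eigenvector of the adjacency matrices -/

namespace KGraph

variable {k : ℕ} {Λ : Type u} [Category.{v} Λ] [KGraph k Λ]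

theorem IsFinite.finite_between (h : IsFinite k Λ) (a b : Λ) (n : Fin k → ℕ) :
    Finite (Between a n b) := by
  have := h n
  refine Finite.of_injective (β := Σ a b : Λ, Between a n b) (fun f => ⟨a, b, f⟩) ?_
  intro f g hfg
  simpa using hfg

/-- The matrix of numbers of morphisms of a given degree. -/
noncomputable def degreeMatrix (n : Fin k → ℕ) : Matrix Λ Λ ℕ :=
  Matrix.of fun a b => Nat.card (Between a n b)

/-- The factorization property as a bijection. -/
noncomputable def factorEquiv (a b : Λ) (m n : Fin k → ℕ) :
    (Σ z : Λ, Between a m z × Between z n b) ≃ Between a (m + n) b :=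
  Equiv.ofBijective
    (fun p => ⟨p.2.2.1 ≫ p.2.1.1, by rw [degree_comp, p.2.1.2, p.2.2.2]⟩) <| by
    constructor
    · rintro ⟨z, ⟨f, hf⟩, ⟨g, hg⟩⟩ ⟨z', ⟨f', hf'⟩, ⟨g', hg'⟩⟩ h
      have h' := congrArg Subtype.val h
      have hd : degree (k := k) (g ≫ f) = m + n := by rw [degree_comp, hf, hg]
      have := (factorization (g ≫ f) m n hd).unique (y₁ := ⟨z, g, f⟩) (y₂ := ⟨z', g', f'⟩)
        ⟨hf, hg, rfl⟩ ⟨hf', hg', h'.symm⟩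
      cases this
      rfl
    · rintro ⟨f, hf⟩
      obtain ⟨⟨z, g, f'⟩, ⟨h1, h2, h3⟩, -⟩ := factorization f m n hf
      exact ⟨⟨z, ⟨f', h1⟩, ⟨g, h2⟩⟩, Subtype.ext h3⟩

variable [Fintype Λ]

theorem degreeMatrix_add (h : IsFinite k Λ) (m n : Fin k → ℕ) :
    (degreeMatrix (m + n) : Matrix Λ Λ ℕ) = degreeMatrix m * degreeMatrix n := by
  have := h.finite_between
  ext a b
  simp only [degreeMatrix, Matrix.mul_apply, Matrix.of_apply]
  rw [← Nat.card_congr (factorEquiv a b m n), Nat.card_sigma]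
  simp [Nat.card_prod]

theorem degreeMatrix_comm (h : IsFinite k Λ) (m n : Fin k → ℕ) :
    (degreeMatrix m * degreeMatrix n : Matrix Λ Λ ℕ) = degreeMatrix n * degreeMatrix m := by
  rw [← degreeMatrix_add h, add_comm, degreeMatrix_add h]

variable [DecidableEq Λ] [Nonempty Λ]

theorem exists_isPerronFrobenius (h : IsFinite k Λ) (hc : StronglyConnected Λ) :
    ∃ x, IsPerronFrobenius k Λ x := by
  have hfin := h.finite_between
  let R (n : Fin k → ℕ) : Matrix Λ Λ ℝ := (degreeMatrix n).map (Nat.castRingHom ℝ)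
  have hR : ∀ m n, R m * R n = R n * R m := fun m n => by
    simp only [R]
    rw [← Matrix.map_mul, degreeMatrix_comm h, Matrix.map_mul]
  have hR0 : ∀ n a b, 0 ≤ R n a b := fun n a b => Nat.cast_nonneg (α := ℝ) _
  let d (a b : Λ) : Fin k → ℕ := degree (hc a b).some
  have hd : ∀ a b, 0 < R (d a b) a b := fun a b => by
    have : Nonempty (Between a (d a b) b) := ⟨⟨(hc a b).some, rfl⟩⟩
    exact Nat.cast_pos.2 (Nat.card_pos (α := Between a (d a b) b))
  -- Strong connectivity supplies a degree making each given entry nonzero; summing over all pairs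
  -- makes every entry positive.
  let T : Matrix Λ Λ ℝ := ∑ p : Λ × Λ, R (d p.1 p.2)
  have hT : ∀ a b, 0 < T a b := fun a b => by
    simp only [T, Matrix.sum_apply]
    exact Finset.sum_pos' (fun p _ => hR0 _ _ _) ⟨(a, b), Finset.mem_univ _, hd a b⟩
  have hTR : ∀ n, T * R n = R n * T := fun n => by
    simp only [T, Finset.sum_mul, Finset.mul_sum, hR n]
  obtain ⟨t, x, hx, hx1, hTx⟩ := Matrix.exists_pos_eigenvector_of_pos hT
  refine ⟨x, hx, hx1, fun i => ?_⟩
  obtain ⟨c, hcx⟩ := Matrix.exists_smul_eq_of_pos_eigenvector hT (y := (R (Pi.single i 1)).mulVec x)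
    hx hTx (by rw [Matrix.mulVec_mulVec, hTR, ← Matrix.mulVec_mulVec, hTx, Matrix.mulVec_smul])
  have hA : ((adjacency k Λ i).map (Nat.cast : ℕ → ℝ)).mulVec x = c • x := hcx
  rw [hA, rho, Matrix.toReal_spectralRadius_eq_of_pos_eigenvector hx hA]

theorem isPerronFrobenius_perronFrobenius (h : IsFinite k Λ) (hc : StronglyConnected Λ) :
    IsPerronFrobenius k Λ (perronFrobenius k Λ) :=
  Classical.epsilon_spec (exists_isPerronFrobenius h hc)

end KGraph

/-! ### Infinite paths and the ultrametric -/

namespace BratteliDiagram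

open Filter Topology

variable {B : BratteliDiagram.{u}} {w : ∀ n, B.FinPath n → ℝ}

/-- Two infinite paths have the same initial segment of length `n`. -/
def InfPath.Agree (n : ℕ) (x y : B.InfPath) : Prop :=
  x.range = y.range ∧ ∀ i < n, x.1 i = y.1 i

namespace InfPath

theorem Agree.refl (n : ℕ) (x : B.InfPath) : Agree n x x := ⟨rfl, fun _ _ => rfl⟩

theorem Agree.symm {n : ℕ} {x y : B.InfPath} (h : Agree n x y) : Agree n y x :=
  ⟨h.1.symm, fun i hi => (h.2 i hi).symm⟩

theorem Agree.trans {n : ℕ} {x y z : B.InfPath} (h : Agree n x y) (h' : Agree n y z) :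
    Agree n x z :=
  ⟨h.1.trans h'.1, fun i hi => (h.2 i hi).trans (h'.2 i hi)⟩

theorem Agree.mono {m n : ℕ} (hmn : m ≤ n) {x y : B.InfPath} (h : Agree n x y) : Agree m x y :=
  ⟨h.1, fun i hi => h.2 i (hi.trans_le hmn)⟩

/-- For `n = 0` no edge is shared, and the range clause of `Agree` is what is needed; otherwise the
vertex is the source of the last shared edge. -/
theorem Agree.vertex_eq {n : ℕ} {x y : B.InfPath} (h : Agree n x y) :
    B.r (x.1 n) = B.r (y.1 n) := by
  cases n with
  | zero => exact h.1
  | succ n => rw [← x.2, ← y.2, h.2 n n.lt_succ_self]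

theorem Agree.take_eq {n : ℕ} {x y : B.InfPath} (h : Agree n x y) : x.take n = y.take n := by
  have h1 : (x.take n).vert = (y.take n).vert := by
    funext i
    exact (h.mono (Nat.lt_succ_iff.1 i.2)).vertex_eq
  have h2 : (x.take n).edge = (y.take n).edge := funext fun i => h.2 i i.2
  cases hx : x.take n
  cases hy : y.take n
  simp only [hx, hy] at h1 h2
  subst h1 h2
  rfl

theorem mem_cylinder_take {n : ℕ} {x y : B.InfPath} :
    y ∈ (x.take n).cylinder ↔ Agree n y x :=
  ⟨fun h => ⟨h.1, fun i hi => h.2 ⟨i, hi⟩⟩, fun h => ⟨h.1, fun i => h.2 i i.2⟩⟩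

theorem agree_firstDiff {x y : B.InfPath} (h : x.range = y.range) :
    Agree (PiNat.firstDiff x.1 y.1) x y :=
  ⟨h, fun _ hi => PiNat.apply_eq_of_lt_firstDiff hi⟩

theorem Agree.le_firstDiff {n : ℕ} {x y : B.InfPath} (h : Agree n x y) (hne : x ≠ y) :
    n ≤ PiNat.firstDiff x.1 y.1 :=
  not_lt.1 fun hlt => PiNat.apply_firstDiff_ne (Subtype.coe_ne_coe.2 hne) (h.2 _ hlt)

/-- The weight of the initial segment of length `n` of an infinite path. -/
def wt (w : ∀ n, B.FinPath n → ℝ) (x : B.InfPath) (n : ℕ) : ℝ := w n (x.take n)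

theorem Agree.wt_eq {n : ℕ} {x y : B.InfPath} (h : Agree n x y) : wt w x n = wt w y n := by
  rw [wt, wt, h.take_eq]

end InfPath

open InfPath

section pathDist

theorem pathDist_of_range_ne {x y : B.InfPath} (h : x.range ≠ y.range) : pathDist w x y = 1 :=
  if_pos h

theorem pathDist_self (x : B.InfPath) : pathDist w x x = 0 := by
  simp [pathDist]

theorem pathDist_of_ne {x y : B.InfPath} (h : x.range = y.range) (hne : x ≠ y) :
    pathDist w x y = wt w x (PiNat.firstDiff x.1 y.1) := by
  simp [pathDist, h, hne, wt]

theorem pathDist_comm (x y : B.InfPath) : pathDist w x y = pathDist w y x := by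
  by_cases h : x.range = y.range
  · by_cases hne : x = y
    · rw [hne]
    · rw [pathDist_of_ne h hne, pathDist_of_ne h.symm (Ne.symm hne), PiNat.firstDiff_comm]
      exact (PiNat.firstDiff_comm x.1 y.1 ▸ agree_firstDiff h).wt_eq
  · rw [pathDist_of_range_ne h, pathDist_of_range_ne (Ne.symm h)]

theorem pathDist_nonneg (hw : ∀ n γ, 0 < w n γ) (x y : B.InfPath) : 0 ≤ pathDist w x y := by
  by_cases h : x.range = y.range
  · by_cases hne : x = y
    · rw [hne, pathDist_self]
    · rw [pathDist_of_ne h hne]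
      exact (hw _ _).le
  · rw [pathDist_of_range_ne h]
    exact zero_le_one

theorem pathDist_le_max (hw : ∀ n γ, 0 < w n γ) (hle : ∀ γ, w 0 γ ≤ 1)
    (hanti : ∀ x, Antitone (wt w x)) (x y z : B.InfPath) :
    pathDist w x z ≤ max (pathDist w x y) (pathDist w y z) := by
  by_cases hxz : x = z
  · rw [hxz, pathDist_self]
    exact (pathDist_nonneg hw _ _).trans (le_max_left _ _)
  have h1 : pathDist w x z ≤ 1 := by
    by_cases h : x.range = z.range
    · rw [pathDist_of_ne h hxz]
      exact (hanti x (Nat.zero_le _)).trans (hle _)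
    · rw [pathDist_of_range_ne h]
  by_cases hxy : x.range = y.range
  swap
  · exact h1.trans (by rw [pathDist_of_range_ne hxy]; exact le_max_left _ _)
  by_cases hyz : y.range = z.range
  swap
  · exact h1.trans (by rw [pathDist_of_range_ne hyz]; exact le_max_right _ _)
  by_cases hxy' : x = y
  · rw [hxy']; exact le_max_right _ _
  by_cases hyz' : y = z
  · rw [hyz']; exact le_max_left _ _
  rw [pathDist_of_ne (hxy.trans hyz) hxz, pathDist_of_ne hxy hxy', pathDist_of_ne hyz hyz']
  rcases min_le_iff.1 (PiNat.min_firstDiff_le x.1 y.1 z.1 (Subtype.coe_ne_coe.2 hxz)) with h | h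
  · exact (hanti x h).trans (le_max_left _ _)
  -- The weight of `y ∧ z` is read along `y`. In the second case `x` and `y` agree beyond that
  -- level, so it can be read along `x`.
  · by_cases h' : PiNat.firstDiff x.1 y.1 ≤ PiNat.firstDiff x.1 z.1
    · exact (hanti x h').trans (le_max_left _ _)
    · refine le_trans ?_ (le_max_right _ _)
      have : PiNat.firstDiff y.1 z.1 ≤ PiNat.firstDiff x.1 y.1 := h.trans (not_le.1 h').le
      rw [← ((agree_firstDiff hxy).mono this).wt_eq]
      exact hanti x h

/-- The ultrametric of a decreasing positive weight. -/
noncomputable abbrev pathMetric (hw : ∀ n γ, 0 < w n γ) (hle : ∀ γ, w 0 γ ≤ 1)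
    (hanti : ∀ x, Antitone (wt w x)) : MetricSpace B.InfPath where
  dist := pathDist w
  dist_self := pathDist_self
  dist_comm := pathDist_comm
  dist_triangle x y z := (pathDist_le_max hw hle hanti x y z).trans
    (max_le_add_of_nonneg (pathDist_nonneg hw _ _) (pathDist_nonneg hw _ _))
  eq_of_dist_eq_zero {x y} h := by
    by_contra hne
    replace h : pathDist w x y = 0 := h
    by_cases hr : x.range = y.range
    · rw [pathDist_of_ne hr hne] at h
      exact (hw _ _).ne' h
    · rw [pathDist_of_range_ne hr] at h
      exact one_ne_zero h

end pathDist

/-! ### Consequences of weights being diameters -/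

section WeightEqDiam

/-- The empty set of reals has no least upper bound. -/
theorem WeightEqDiam.nonempty_cylinder (hd : WeightEqDiam w) {n : ℕ} (γ : B.FinPath n) :
    γ.cylinder.Nonempty := by
  obtain ⟨_, x, hx, -⟩ := (hd n γ).nonempty
  exact ⟨x, hx⟩

theorem WeightEqDiam.pathDist_le (hd : WeightEqDiam w) {n : ℕ} {x y z : B.InfPath}
    (hy : Agree n y x) (hz : Agree n z x) : pathDist w y z ≤ wt w x n :=
  (hd n (x.take n)).1 ⟨y, mem_cylinder_take.2 hy, z, mem_cylinder_take.2 hz, rfl⟩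

theorem WeightEqDiam.antitone (hd : WeightEqDiam w) (x : B.InfPath) : Antitone (wt w x) := by
  intro m n hmn
  refine (hd n (x.take n)).2 ?_
  rintro _ ⟨y, hy, z, hz, rfl⟩
  exact hd.pathDist_le ((mem_cylinder_take.1 hy).mono hmn) ((mem_cylinder_take.1 hz).mono hmn)

theorem WeightEqDiam.exists_ne (hd : WeightEqDiam w) (hw : ∀ n γ, 0 < w n γ) (x : B.InfPath)
    (n : ℕ) : ∃ y, Agree n y x ∧ y ≠ x := by
  by_contra! h
  refine (hw n (x.take n)).not_ge ((hd n (x.take n)).2 ?_)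
  rintro _ ⟨y, hy, z, hz, rfl⟩
  rw [h y (mem_cylinder_take.1 hy), h z (mem_cylinder_take.1 hz), pathDist_self]

theorem WeightEqDiam.exists_range_eq (hd : WeightEqDiam w) (a : B.V 0) :
    ∃ x : B.InfPath, x.range = a := by
  obtain ⟨x, hx⟩ := hd.nonempty_cylinder (n := 0)
    { vert := Fin.cases a fun j => j.elim0
      edge := fun i => i.elim0
      range_edge := fun i => i.elim0
      source_edge := fun i => i.elim0 }
  exact ⟨x, hx.1⟩

theorem WeightEqDiam.exists_extension (hd : WeightEqDiam w) (x : B.InfPath) (n : ℕ) (e : B.E n)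
    (he : B.r e = B.r (x.1 n)) : ∃ y, Agree n y x ∧ y.1 n = e := by
  -- Full sequences `a`, `b` carry the data of the finite path; their entries past its end play no
  -- role.
  obtain ⟨a, ha, ha'⟩ : ∃ a : ∀ m, B.V m, (∀ m ≤ n, a m = B.r (x.1 m)) ∧ a (n + 1) = B.s e :=
    ⟨Function.update (fun m => B.r (x.1 m)) (n + 1) (B.s e),
      fun m hm => Function.update_of_ne (Nat.lt_succ_of_le hm).ne _ _, Function.update_self _ _ _⟩
  obtain ⟨b, hb, hb'⟩ : ∃ b : ∀ m, B.E m, (∀ m < n, b m = x.1 m) ∧ b n = e :=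
    ⟨Function.update x.1 n e, fun m hm => Function.update_of_ne hm.ne _ _,
      Function.update_self _ _ _⟩
  have hr : ∀ i ≤ n, B.r (b i) = a i := by
    intro i hi
    rw [ha i hi]
    rcases hi.eq_or_lt with rfl | h
    · rw [hb', he]
    · rw [hb i h]
  have hs : ∀ i ≤ n, B.s (b i) = a (i + 1) := by
    intro i hi
    rcases hi.eq_or_lt with rfl | h
    · rw [hb', ha']
    · rw [hb i h, ha (i + 1) h]
      exact x.2 i
  obtain ⟨y, hy⟩ := hd.nonempty_cylinder (n := n + 1)
    { vert := fun i => a i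
      edge := fun i => b i
      range_edge := fun i => hr i (Nat.lt_succ_iff.1 i.2)
      source_edge := fun i => hs i (Nat.lt_succ_iff.1 i.2) }
  exact ⟨y, ⟨hy.1.trans (ha 0 (Nat.zero_le _)),
    fun i hi => (hy.2 ⟨i, hi.trans n.lt_succ_self⟩).trans (hb i hi)⟩,
    (hy.2 ⟨n, n.lt_succ_self⟩).trans hb'⟩

theorem WeightEqDiam.ediam_cylinder_le [MetricSpace B.InfPath] (hd : WeightEqDiam w)
    (hm : ∀ x y : B.InfPath, dist x y = pathDist w x y) (x : B.InfPath) (n : ℕ) :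
    Metric.ediam {y | Agree n y x} ≤ ENNReal.ofReal (wt w x n) := by
  refine Metric.ediam_le fun y hy z hz => ?_
  rw [edist_dist, hm]
  exact ENNReal.ofReal_le_ofReal (hd.pathDist_le hy hz)

end WeightEqDiam

/-! ### Transversals and compactness -/

/-- A finite set containing exactly one path from each cylinder of level `n`. -/
structure IsTransversal (n : ℕ) (F : Finset B.InfPath) : Prop where
  exists_agree : ∀ x, ∃ y ∈ F, Agree n y x
  eq_of_agree : ∀ x ∈ F, ∀ y ∈ F, Agree n x y → x = y

theorem exists_isTransversal (n : ℕ) : ∃ F : Finset B.InfPath, IsTransversal n F := by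
  have := B.finite_V
  have := B.finite_E
  let f (x : B.InfPath) : B.V 0 × ∀ i : Fin n, B.E i := (x.range, fun i => x.1 i)
  have hf : ∀ x y, f x = f y → Agree n x y := fun x y h =>
    ⟨congrArg Prod.fst h, fun i hi => congrFun (congrArg Prod.snd h) ⟨i, hi⟩⟩
  have hf' : ∀ x y, Agree n x y → f x = f y := fun x y h =>
    Prod.ext h.1 (funext fun i => h.2 i i.2)
  obtain ⟨t, -, ht⟩ := Set.exists_subset_bijOn Set.univ f
  have hfin : t.Finite := Set.Finite.of_finite_image (Set.toFinite _) ht.injOn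
  refine ⟨hfin.toFinset, fun x => ?_, fun x hx y hy h => ?_⟩
  · obtain ⟨y, hy, hyx⟩ := ht.surjOn ⟨x, Set.mem_univ x, rfl⟩
    exact ⟨y, hfin.mem_toFinset.2 hy, hf _ _ hyx⟩
  · exact ht.injOn (hfin.mem_toFinset.1 hx) (hfin.mem_toFinset.1 hy) (hf' _ _ h)

/-- Compactness of the infinite path space. -/
theorem exists_finset_cover {U : ℕ → Set B.InfPath}
    (hU : ∀ j, ∀ x ∈ U j, ∃ n, ∀ y, Agree n y x → y ∈ U j) (hcov : ∀ x, ∃ j, x ∈ U j) :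
    ∃ s : Finset ℕ, ∀ x, ∃ j ∈ s, x ∈ U j := by
  have := B.finite_E
  let (n : ℕ) : TopologicalSpace (B.E n) := ⊥
  have (n : ℕ) : DiscreteTopology (B.E n) := ⟨rfl⟩
  let (n : ℕ) : TopologicalSpace (B.V n) := ⊥
  have (n : ℕ) : DiscreteTopology (B.V n) := ⟨rfl⟩
  -- The product topology of finite discrete sets, in which the path space is closed; no metric is
  -- involved.
  let : TopologicalSpace B.InfPath := instTopologicalSpaceSubtype
  have hc (n : ℕ) : Continuous fun x : B.InfPath => x.1 n :=
    (continuous_apply n).comp continuous_subtype_val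
  have : CompactSpace B.InfPath := by
    refine isCompact_iff_compactSpace.1 (IsClosed.isCompact ?_)
    change IsClosed {x : ∀ n, B.E n | ∀ n, B.s (x n) = B.r (x (n + 1))}
    simp only [Set.ofPred_forall]
    refine isClosed_iInter fun n => isClosed_eq ?_ ?_
    · exact continuous_of_discreteTopology.comp (continuous_apply n)
    · exact continuous_of_discreteTopology.comp (continuous_apply (n + 1))
  have hopen : ∀ n (x : B.InfPath), IsOpen {y | Agree n y x} := by
    intro n x
    have : {y | Agree n y x} =
        (fun y : B.InfPath => B.r (y.1 0)) ⁻¹' {x.range} ∩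
          ⋂ i ∈ Finset.range n, (fun y : B.InfPath => y.1 i) ⁻¹' {x.1 i} := by
      ext y
      simp [Agree, InfPath.range]
    rw [this]
    refine ((isOpen_discrete _).preimage (continuous_of_discreteTopology.comp (hc 0))).inter ?_
    exact isOpen_biInter_finset fun i _ => (isOpen_discrete _).preimage (hc i)
  have hUo : ∀ j, IsOpen (U j) := by
    intro j
    rw [isOpen_iff_forall_mem_open]
    intro x hx
    obtain ⟨n, hn⟩ := hU j x hx
    exact ⟨_, hn, hopen n x, Agree.refl n x⟩
  obtain ⟨s, hs⟩ := isCompact_univ.elim_finite_subcover U hUo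
    fun x _ => Set.mem_iUnion.2 (hcov x)
  refine ⟨s, fun x => ?_⟩
  simpa using hs (Set.mem_univ x)

end BratteliDiagram

/-! ### Masses of cylinders -/

namespace BratteliDiagram

open Filter Topology InfPath
open scoped ENNReal

variable {B : BratteliDiagram.{u}} [∀ n, Fintype (B.V n)] [∀ n, Fintype (B.E n)]
  {w : ∀ n, B.FinPath n → ℝ} {δ : ℝ} {c : ℕ → ℝ} {ξ : ∀ n, B.V n → ℝ}

open Classical in
/-- The numbers `c n * ξ n (s γ)` are the masses of the cylinders of a probability measure, whose
`1 / δ`-th powers are comparable to the weights of the cylinders. -/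
structure IsMass (w : ∀ n, B.FinPath n → ℝ) (δ : ℝ) (c : ℕ → ℝ) (ξ : ∀ n, B.V n → ℝ) : Prop where
  coeff_pos : ∀ n, 0 < c n
  coeff_zero : c 0 = 1
  vertex_pos : ∀ n a, 0 < ξ n a
  sum_vertex : ∑ a, ξ 0 a = 1
  vertex_le_one : ∀ n a, ξ n a ≤ 1
  split : ∀ n a, ∑ e : B.E n, (if B.r e = a then c (n + 1) * ξ (n + 1) (B.s e) else 0) = c n * ξ n a
  weight_eq : ∀ n γ, w n γ = c n ^ (1 / δ) * ξ n γ.source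

/-- The mass of the cylinder of level `n` around an infinite path. -/
def InfPath.mass (c : ℕ → ℝ) (ξ : ∀ n, B.V n → ℝ) (x : B.InfPath) (n : ℕ) : ℝ :=
  c n * ξ n (B.r (x.1 n))

namespace IsMass

theorem weight_pos (h : IsMass w δ c ξ) (n : ℕ) (γ : B.FinPath n) : 0 < w n γ := by
  rw [h.weight_eq]
  exact mul_pos (Real.rpow_pos_of_pos (h.coeff_pos n) _) (h.vertex_pos _ _)

theorem wt_pos (h : IsMass w δ c ξ) (x : B.InfPath) (n : ℕ) : 0 < wt w x n :=
  h.weight_pos n _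

theorem weight_zero_le_one (h : IsMass w δ c ξ) (γ : B.FinPath 0) : w 0 γ ≤ 1 := by
  rw [h.weight_eq, h.coeff_zero, Real.one_rpow, one_mul]
  exact h.vertex_le_one _ _

theorem mass_pos (h : IsMass w δ c ξ) (x : B.InfPath) (n : ℕ) : 0 < x.mass c ξ n :=
  mul_pos (h.coeff_pos n) (h.vertex_pos _ _)

theorem wt_rpow (h : IsMass w δ c ξ) (hδ : 0 < δ) (x : B.InfPath) (n : ℕ) :
    wt w x n ^ δ = c n * ξ n (B.r (x.1 n)) ^ δ := by
  have h1 : wt w x n = c n ^ (1 / δ) * ξ n (B.r (x.1 n)) := h.weight_eq _ _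
  rw [h1, Real.mul_rpow (Real.rpow_nonneg (h.coeff_pos n).le _) (h.vertex_pos _ _).le,
    ← Real.rpow_mul (h.coeff_pos n).le, one_div_mul_cancel hδ.ne', Real.rpow_one]

theorem mass_le_wt_rpow (h : IsMass w δ c ξ) (hδ : 0 < δ) (hδ1 : δ ≤ 1) (x : B.InfPath) (n : ℕ) :
    x.mass c ξ n ≤ wt w x n ^ δ := by
  rw [h.wt_rpow hδ]
  refine mul_le_mul_of_nonneg_left ?_ (h.coeff_pos n).le
  exact Real.self_le_rpow_of_le_one (h.vertex_pos _ _).le (h.vertex_le_one _ _) hδ1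

open Classical in
/-- The mass of a cylinder is the sum of the masses of the cylinders of a deeper level in it. -/
theorem sum_transversal (h : IsMass w δ c ξ) (hd : WeightEqDiam w) {N : ℕ} {F : Finset B.InfPath}
    (hF : IsTransversal N F) {n : ℕ} (hn : n ≤ N) (x : B.InfPath) :
    ∑ y ∈ F with Agree n y x, y.mass c ξ N = x.mass c ξ n := by
  induction hn using Nat.decreasingInduction generalizing x with
  | self =>
    obtain ⟨y, hy, hyx⟩ := hF.exists_agree x
    rw [Finset.sum_eq_single_of_mem y (by simp [hy, hyx])]
    · rw [InfPath.mass, InfPath.mass, hyx.vertex_eq]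
    · intro z hz hne
      rw [Finset.mem_filter] at hz
      exact absurd (hF.eq_of_agree z hz.1 y hy (hz.2.trans hyx.symm)) hne
  | of_succ n hn ih =>
    rw [← Finset.sum_fiberwise _ (fun y : B.InfPath => y.1 n), InfPath.mass, ← h.split]
    refine Finset.sum_congr rfl fun e _ => ?_
    split_ifs with he
    -- The fibre over `e` is the cylinder of level `n + 1` around `z`, to which the induction
    -- hypothesis applies.
    · obtain ⟨z, hz, hze⟩ := hd.exists_extension x n e he
      have h1 := ih z
      rw [InfPath.mass, ← z.2, hze] at h1
      rw [← h1, Finset.filter_filter]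
      refine Finset.sum_congr (Finset.filter_congr fun y _ => ?_) fun _ _ => rfl
      constructor
      · rintro ⟨hyx, hye⟩
        refine ⟨hyx.1.trans hz.1.symm, fun i hi => ?_⟩
        rcases (Nat.lt_succ_iff.1 hi).eq_or_lt with rfl | hi
        · rw [hye, hze]
        · rw [hyx.2 i hi, hz.2 i hi]
      · intro hyz
        exact ⟨(hyz.mono n.le_succ).trans hz, (hyz.2 n n.lt_succ_self).trans hze⟩
    · refine Finset.sum_eq_zero fun y hy => absurd ?_ he
      rw [Finset.mem_filter, Finset.mem_filter] at hy
      rw [← hy.2, hy.1.2.vertex_eq]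

theorem sum_transversal_eq_one (h : IsMass w δ c ξ) (hd : WeightEqDiam w) {N : ℕ}
    {F : Finset B.InfPath} (hF : IsTransversal N F) : ∑ y ∈ F, y.mass c ξ N = 1 := by
  classical
  rw [← h.sum_vertex, ← Finset.sum_fiberwise F (fun y : B.InfPath => y.range)]
  refine Finset.sum_congr rfl fun a _ => ?_
  obtain ⟨x, rfl⟩ := hd.exists_range_eq a
  have h1 := h.sum_transversal hd hF (Nat.zero_le N) x
  rw [InfPath.mass, h.coeff_zero, one_mul] at h1
  refine Eq.trans (Finset.sum_congr (Finset.filter_congr fun y _ => ?_) fun _ _ => rfl) h1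
  simp [Agree]

/-- Since every cylinder has at least two points, the coefficients become smaller than one. -/
theorem eventually_coeff_lt_one (h : IsMass w δ c ξ) (hd : WeightEqDiam w) {a : B.V 0}
    (ha : ∀ n b, ξ 0 a ≤ ξ n b) : ∀ᶠ n in atTop, c n < 1 := by
  classical
  obtain ⟨x, hx⟩ := hd.exists_range_eq a
  obtain ⟨y, hyx, hne⟩ := hd.exists_ne h.weight_pos x 0
  filter_upwards [eventually_gt_atTop (PiNat.firstDiff y.1 x.1)] with N hN
  obtain ⟨F, hF⟩ := exists_isTransversal (B := B) N
  obtain ⟨x', hx'F, hx'⟩ := hF.exists_agree x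
  obtain ⟨y', hy'F, hy'⟩ := hF.exists_agree y
  have hne' : x' ≠ y' := by
    rintro rfl
    exact hN.not_ge ((hy'.symm.trans hx').le_firstDiff hne)
  have h1 := h.sum_transversal hd hF (Nat.zero_le N) x
  have h2 : ∑ z ∈ {x', y'}, z.mass c ξ N ≤ ∑ z ∈ F with Agree 0 z x, z.mass c ξ N := by
    refine Finset.sum_le_sum_of_subset_of_nonneg ?_ fun z _ _ => (h.mass_pos z N).le
    intro z hz
    rw [Finset.mem_insert, Finset.mem_singleton] at hz
    rw [Finset.mem_filter]
    rcases hz with rfl | rfl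
    · exact ⟨hx'F, hx'.mono (Nat.zero_le N)⟩
    · exact ⟨hy'F, (hy'.mono (Nat.zero_le N)).trans hyx⟩
  rw [h1, Finset.sum_pair hne', InfPath.mass, InfPath.mass, InfPath.mass, h.coeff_zero, one_mul,
    show B.r (x.1 0) = a from hx] at h2
  -- Two disjoint cylinders lie over `a`. If `1 ≤ c N`, minimality of `ξ 0 a` gives each of them
  -- mass at least `ξ 0 a`, the mass of the whole.
  by_contra! hc
  have h3 : ∀ b, ξ 0 a ≤ c N * ξ N b := fun b =>
    (ha N b).trans (le_mul_of_one_le_left (h.vertex_pos _ _).le hc)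
  linarith [h3 (B.r (x'.1 N)), h3 (B.r (y'.1 N)), h.vertex_pos 0 a]

/-! ### The two Hausdorff measure bounds -/

section Hausdorff

variable [MetricSpace B.InfPath]

open Classical in
/-- Every set lies in an open set of mass almost bounded by a power of its diameter. -/
theorem exists_cover_mass_le (h : IsMass w δ c ξ) (hδ : 0 < δ) (hδ1 : δ ≤ 1)
    (hm : ∀ x y : B.InfPath, dist x y = pathDist w x y) (hd : WeightEqDiam w) {u : ℕ → ℕ}
    (hu : Tendsto (fun q => c (u q)) atTop (𝓝 0)) (t : Set B.InfPath) {ε : ℝ≥0∞} (hε : 0 < ε) :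
    ∃ U : Set B.InfPath, t ⊆ U ∧ (∀ x ∈ U, ∃ n, ∀ y, Agree n y x → y ∈ U) ∧
      ∃ n₀, ∀ N ≥ n₀, ∀ F, IsTransversal N F →
        ∑ y ∈ F with y ∈ U, ENNReal.ofReal (y.mass c ξ N) ≤
          (⨆ _ : t.Nonempty, Metric.ediam t ^ δ) + ε := by
  rcases t.eq_empty_or_nonempty with rfl | ht
  · exact ⟨∅, le_rfl, by simp, 0, by simp⟩
  simp only [iSup_pos ht]
  have hcyl : ∀ (x : B.InfPath) (n : ℕ), t ⊆ {y | Agree n y x} →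
      ENNReal.ofReal (x.mass c ξ n) ≤ Metric.ediam t ^ δ + ε →
      ∃ U : Set B.InfPath, t ⊆ U ∧ (∀ x ∈ U, ∃ n, ∀ y, Agree n y x → y ∈ U) ∧
        ∃ n₀, ∀ N ≥ n₀, ∀ F, IsTransversal N F →
          ∑ y ∈ F with y ∈ U, ENNReal.ofReal (y.mass c ξ N) ≤ Metric.ediam t ^ δ + ε := by
    intro x n htx hle
    refine ⟨{y | Agree n y x}, htx, fun y hy => ⟨n, fun z hz => hz.trans hy⟩, n,
      fun N hN F hF => ?_⟩
    rw [← ENNReal.ofReal_sum_of_nonneg fun y _ => (h.mass_pos y N).le]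
    simp only [Set.mem_ofPred_eq]
    rwa [h.sum_transversal hd hF hN x]
  by_cases hr : ∃ x ∈ t, ∃ y ∈ t, x.range ≠ y.range
  · obtain ⟨x, hx, y, hy, hxy⟩ := hr
    refine ⟨Set.univ, Set.subset_univ _, fun x _ => ⟨0, fun y _ => Set.mem_univ y⟩, 0,
      fun N _ F hF => ?_⟩
    have h1 : (1 : ℝ≥0∞) ≤ Metric.ediam t := by
      have := Metric.edist_le_ediam_of_mem hx hy
      rwa [edist_dist, hm, pathDist_of_range_ne hxy, ENNReal.ofReal_one] at this
    simp only [Set.mem_univ, Finset.filter_true]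
    rw [← ENNReal.ofReal_sum_of_nonneg fun y _ => (h.mass_pos y N).le,
      h.sum_transversal_eq_one hd hF, ENNReal.ofReal_one]
    exact (ENNReal.one_le_rpow h1 hδ).trans le_self_add
  push Not at hr
  -- A single point has diameter `0`, so `ε` must absorb the mass of a small cylinder around it.
  -- Otherwise the shortest `x ∧ y` over pairs in `t` defines a cylinder containing `t`, and its
  -- weight is a distance attained in `t`.
  rcases t.subsingleton_or_nontrivial with hs | hs
  · obtain ⟨x, hx⟩ := ht
    have hlim : Tendsto (fun q => ENNReal.ofReal (c (u q))) atTop (𝓝 0) := by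
      simpa using ENNReal.tendsto_ofReal hu
    obtain ⟨q, hq⟩ := (hlim.eventually_lt_const hε).exists
    refine hcyl x (u q) (fun y hy => ?_) ?_
    · rw [hs hy hx]
      exact Agree.refl _ _
    · refine le_trans (le_trans (ENNReal.ofReal_le_ofReal ?_) hq.le) le_add_self
      exact mul_le_of_le_one_right (h.coeff_pos _).le (h.vertex_le_one _ _)
  · have hex : ∃ n, ∃ x ∈ t, ∃ y ∈ t, x ≠ y ∧ PiNat.firstDiff x.1 y.1 = n := by
      obtain ⟨x, hx, y, hy, hxy⟩ := hs
      exact ⟨_, x, hx, y, hy, hxy, rfl⟩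
    obtain ⟨x, hx, y, hy, hxy, hn⟩ := Nat.find_spec hex
    refine hcyl x (Nat.find hex) (fun z hz => ?_) ?_
    · by_cases hzx : z = x
      · rw [hzx]
        exact Agree.refl _ _
      · exact (agree_firstDiff (hr z hz x hx)).mono
          (Nat.find_min' hex ⟨z, hz, x, hx, hzx, rfl⟩)
    · refine le_trans ?_ le_self_add
      have h1 := Metric.edist_le_ediam_of_mem hx hy
      rw [edist_dist, hm, pathDist_of_ne (hr x hx y hy) hxy, hn] at h1
      refine le_trans ?_ (ENNReal.rpow_le_rpow h1 hδ.le)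
      rw [ENNReal.ofReal_rpow_of_pos (h.wt_pos _ _)]
      exact ENNReal.ofReal_le_ofReal (h.mass_le_wt_rpow hδ hδ1 x _)

variable [MeasurableSpace B.InfPath] [BorelSpace B.InfPath]

theorem hausdorffMeasure_lt_top (h : IsMass w δ c ξ) (hδ : 0 < δ)
    (hm : ∀ x y : B.InfPath, dist x y = pathDist w x y) (hd : WeightEqDiam w)
    {a : B.V 0} (ha : ∀ n b, ξ 0 a ≤ ξ n b) {u : ℕ → ℕ}
    (hu : Tendsto (fun q => c (u q)) atTop (𝓝 0)) :
    Measure.hausdorffMeasure δ (Set.univ : Set B.InfPath) < ⊤ := by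
  choose F hF using fun q => exists_isTransversal (B := B) (u q)
  have hr : Tendsto (fun q => ENNReal.ofReal (c (u q) ^ (1 / δ))) atTop (𝓝 0) := by
    have := hu.rpow_const (p := 1 / δ) (Or.inr (by positivity))
    rw [Real.zero_rpow (by positivity)] at this
    simpa using ENNReal.tendsto_ofReal this
  have hwt : ∀ (x : B.InfPath) n, wt w x n ≤ c n ^ (1 / δ) := fun x n => by
    rw [wt, h.weight_eq]
    exact mul_le_of_le_one_right (Real.rpow_nonneg (h.coeff_pos n).le _) (h.vertex_le_one _ _)
  refine lt_of_le_of_lt (Measure.hausdorffMeasure_le_liminf_sum (ι := fun q => F q) δ Set.univ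
    _ hr (fun q x => {y | Agree (u q) y x}) ?_ ?_) ?_
  · exact Eventually.of_forall fun q x => (hd.ediam_cylinder_le hm _ _).trans
      (ENNReal.ofReal_le_ofReal (hwt _ _))
  · refine Eventually.of_forall fun q x _ => ?_
    obtain ⟨y, hy, hyx⟩ := (hF q).exists_agree x
    exact Set.mem_iUnion.2 ⟨⟨y, hy⟩, hyx.symm⟩
  · refine lt_of_le_of_lt (b := ENNReal.ofReal (ξ 0 a)⁻¹) ?_ ENNReal.ofReal_lt_top
    refine liminf_le_of_frequently_le' (Frequently.of_forall fun q => ?_)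
    calc ∑ x : F q, Metric.ediam {y | Agree (u q) y x.1} ^ δ
        ≤ ∑ x : F q, ENNReal.ofReal ((ξ 0 a)⁻¹ * x.1.mass c ξ (u q)) := by
          refine Finset.sum_le_sum fun x _ => ?_
          refine (ENNReal.rpow_le_rpow (hd.ediam_cylinder_le hm _ _) hδ.le).trans ?_
          rw [ENNReal.ofReal_rpow_of_pos (h.wt_pos _ _), h.wt_rpow hδ, InfPath.mass,
            mul_left_comm]
          refine ENNReal.ofReal_le_ofReal (mul_le_mul_of_nonneg_left ?_ (h.coeff_pos _).le)
          -- Here `ξ ^ δ ≤ 1 ≤ ξ / ξ 0 a`, the source of the constant `(ξ 0 a)⁻¹`.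
          refine (Real.rpow_le_one (h.vertex_pos _ _).le (h.vertex_le_one _ _) hδ.le).trans ?_
          rw [inv_mul_eq_div, one_le_div (h.vertex_pos _ _)]
          exact ha _ _
      _ = ENNReal.ofReal (ξ 0 a)⁻¹ := by
          rw [Finset.sum_coe_sort (F q) fun x => ENNReal.ofReal ((ξ 0 a)⁻¹ * x.mass c ξ (u q)),
            ← ENNReal.ofReal_sum_of_nonneg, ← Finset.mul_sum, h.sum_transversal_eq_one hd (hF q),
            mul_one]
          exact fun x _ => mul_nonneg (inv_nonneg.2 (h.vertex_pos _ _).le) (h.mass_pos _ _).le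

theorem one_le_hausdorffMeasure (h : IsMass w δ c ξ) (hδ : 0 < δ) (hδ1 : δ ≤ 1)
    (hm : ∀ x y : B.InfPath, dist x y = pathDist w x y) (hd : WeightEqDiam w) {u : ℕ → ℕ}
    (hu : Tendsto (fun q => c (u q)) atTop (𝓝 0)) :
    1 ≤ Measure.hausdorffMeasure δ (Set.univ : Set B.InfPath) := by
  classical
  rw [Measure.hausdorffMeasure_apply]
  -- The estimate holds for every countable cover, so the scale `1` is arbitrary and the diameter
  -- restriction is dropped.
  refine le_iSup₂_of_le 1 one_pos (le_iInf fun t => le_iInf fun ht => le_iInf fun _ => ?_)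
  refine ENNReal.le_of_forall_pos_le_add fun ε hε _ => ?_
  obtain ⟨ε', hε', hsum⟩ := ENNReal.exists_pos_sum_of_countable' (ENNReal.coe_pos.2 hε).ne' ℕ
  choose U htU hU n₀ hn₀ using
    fun j => h.exists_cover_mass_le hδ hδ1 hm hd hu (t j) (hε' j)
  obtain ⟨s, hs⟩ := exists_finset_cover hU fun x => by
    obtain ⟨j, hj⟩ := Set.mem_iUnion.1 (ht (Set.mem_univ x))
    exact ⟨j, htU j hj⟩
  obtain ⟨F, hF⟩ := exists_isTransversal (B := B) (s.sup n₀)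
  calc (1 : ℝ≥0∞) = ∑ y ∈ F, ENNReal.ofReal (y.mass c ξ (s.sup n₀)) := by
        rw [← ENNReal.ofReal_sum_of_nonneg fun y _ => (h.mass_pos y _).le,
          h.sum_transversal_eq_one hd hF, ENNReal.ofReal_one]
    _ ≤ ∑ y ∈ F, ∑ j ∈ s, if y ∈ U j then ENNReal.ofReal (y.mass c ξ (s.sup n₀)) else 0 := by
        refine Finset.sum_le_sum fun y _ => ?_
        obtain ⟨j, hj, hyj⟩ := hs y
        refine le_trans ?_ (Finset.single_le_sum (fun _ _ => zero_le) hj)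
        rw [if_pos hyj]
    _ = ∑ j ∈ s, ∑ y ∈ F with y ∈ U j, ENNReal.ofReal (y.mass c ξ (s.sup n₀)) := by
        rw [Finset.sum_comm]
        exact Finset.sum_congr rfl fun j _ => (Finset.sum_filter _ _).symm
    _ ≤ ∑ j ∈ s, ((⨆ _ : (t j).Nonempty, Metric.ediam (t j) ^ δ) + ε' j) :=
        Finset.sum_le_sum fun j hj => hn₀ j _ (Finset.le_sup hj) F hF
    _ ≤ ∑' j, ((⨆ _ : (t j).Nonempty, Metric.ediam (t j) ^ δ) + ε' j) := ENNReal.sum_le_tsum _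
    _ ≤ _ := by
        rw [ENNReal.tsum_add]
        gcongr

end Hausdorff

end IsMass

end BratteliDiagram

/-! ### The weight of a `k`-graph as a mass -/

namespace KGraph

open Filter Topology BratteliDiagram

variable {k : ℕ} [NeZero k] {Λ : Type u} [Category.{v} Λ] [KGraph k Λ] [Fintype Λ] [DecidableEq Λ]

/-- The edges between two levels of a stationary Bratteli diagram. -/
abbrev fintypeEdges {N : Type u} [Fintype N] (A : N → N → ℕ) :
    Fintype (Σ p q : N, Fin (A p q)) :=
  inferInstance

theorem sum_edges {N : Type u} [Fintype N] [DecidableEq N] (A : N → N → ℕ) (a : N) (f : N → ℝ) :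
    ∑ e : Σ p q : N, Fin (A p q), (if e.1 = a then f e.2.1 else 0) = ∑ q, (A a q : ℝ) * f q := by
  simp only [Fintype.sum_sigma, Finset.sum_const, Finset.card_univ, Fintype.card_fin,
    nsmul_eq_mul, mul_ite, mul_zero]
  rw [Finset.sum_eq_single a (fun p _ hp => by simp [hp]) (by simp)]
  simp

instance (n : ℕ) : Fintype ((bratteli k Λ).V n) := inferInstanceAs (Fintype Λ)

noncomputable instance (n : ℕ) : Fintype ((bratteli k Λ).E n) :=
  fintypeEdges (adjacency k Λ (Fin.ofNat k n))

variable (k Λ) in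
/-- The product `ρ_1^{q+1} ⋯ ρ_t^{q+1} ρ_{t+1}^q ⋯ ρ_k^q` for `n = qk + t`. -/
noncomputable def rhoProd (n : ℕ) : ℝ :=
  ∏ i : Fin k, rho k Λ i ^ (if (i : ℕ) < n % k then n / k + 1 else n / k)

theorem rhoProd_succ (n : ℕ) : rhoProd k Λ (n + 1) = rho k Λ (Fin.ofNat k n) * rhoProd k Λ n := by
  have hk : 0 < k := NeZero.pos k
  have hexp : ∀ i : Fin k,
      (if (i : ℕ) < (n + 1) % k then (n + 1) / k + 1 else (n + 1) / k) =
        (if (i : ℕ) < n % k then n / k + 1 else n / k) + if i = Fin.ofNat k n then 1 else 0 := by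
    intro i
    have hi : (i = Fin.ofNat k n) ↔ (i : ℕ) = n % k := by
      rw [Fin.ext_iff]; rfl
    have hik := i.2
    have hlt := Nat.mod_lt n hk
    simp only [hi]
    -- Here the remainder wraps to `0` and the quotient grows; otherwise only the remainder grows.
    by_cases hc : n % k + 1 = k
    · have hdvd : k ∣ n + 1 := by
        refine ⟨n / k + 1, ?_⟩
        have := Nat.div_add_mod n k
        rw [mul_add, mul_one]
        omega
      rw [Nat.succ_div_of_dvd hdvd, Nat.mod_eq_zero_of_dvd hdvd]
      split_ifs <;> omega
    · have h1 : (n + 1) % k = n % k + 1 := by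
        have h2 : 1 % k = 1 := Nat.mod_eq_of_lt (by omega)
        rw [Nat.add_mod_of_add_mod_lt (by omega), h2]
      have hdvd : ¬ k ∣ n + 1 := by
        rw [Nat.dvd_iff_mod_eq_zero]; omega
      rw [Nat.succ_div_of_not_dvd hdvd, h1]
      split_ifs <;> omega
  simp only [rhoProd, hexp, pow_add, Finset.prod_mul_distrib]
  rw [mul_comm]
  congr 1
  simp [Finset.prod_ite_eq', pow_ite]

omit [NeZero k] in
theorem rhoProd_zero : rhoProd k Λ 0 = 1 := by simp [rhoProd]

theorem rhoProd_mul (q : ℕ) : rhoProd k Λ (q * k) = (∏ i, rho k Λ i) ^ q := by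
  simp [rhoProd, Nat.mul_div_cancel _ (NeZero.pos k), Finset.prod_pow]

/-- The Perron–Frobenius eigenvector as a function on the vertices of the Bratteli diagram. -/
noncomputable def vertexMass (n : ℕ) (a : (bratteli k Λ).V n) : ℝ := perronFrobenius k Λ a

/-- The path supplies an edge at level `i`, hence a nonzero entry of `A_i`; the corresponding row of
the eigenvector equation is positive. -/
theorem rho_pos (hpf : IsPerronFrobenius k Λ (perronFrobenius k Λ))
    (x : (bratteli k Λ).InfPath) (i : Fin k) : 0 < rho k Λ i := by
  obtain ⟨p, q, e⟩ := x.1 i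
  have hi : Fin.ofNat k (i : ℕ) = i := by simp
  have hpos : 0 < adjacency k Λ i p q := by
    rw [← congrArg (fun j => adjacency k Λ j p q) hi]
    exact e.pos
  have h1 : ∑ b, (adjacency k Λ i p b : ℝ) * perronFrobenius k Λ b =
      rho k Λ i * perronFrobenius k Λ p := congrFun (hpf.2.2 i) p
  refine pos_of_mul_pos_left (b := perronFrobenius k Λ p) ?_ (hpf.1 p).le
  rw [← h1]
  exact Finset.sum_pos' (fun b _ => mul_nonneg (Nat.cast_nonneg _) (hpf.1 b).le)
    ⟨q, Finset.mem_univ q, mul_pos (Nat.cast_pos.2 hpos) (hpf.1 q)⟩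

theorem isMass_weight (hpf : IsPerronFrobenius k Λ (perronFrobenius k Λ))
    (hρ : ∀ i, 0 < rho k Λ i) (δ : ℝ) :
    IsMass (weight k Λ δ) δ (fun n => (rhoProd k Λ n)⁻¹) vertexMass := by
  classical
  have hpos : ∀ n, 0 < rhoProd k Λ n := fun n => Finset.prod_pos fun i _ => pow_pos (hρ i) _
  refine ⟨fun n => inv_pos.2 (hpos n), by simp [rhoProd_zero], fun n a => hpf.1 a, hpf.2.1,
    fun n a => ?_, fun n a => ?_, fun n γ => ?_⟩
  · exact hpf.2.1 ▸ Finset.single_le_sum (fun b _ => (hpf.1 b).le) (Finset.mem_univ (a : Λ))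
  · have h1 : ∑ b, (adjacency k Λ (Fin.ofNat k n) a b : ℝ) * perronFrobenius k Λ b =
      rho k Λ (Fin.ofNat k n) * perronFrobenius k Λ a := congrFun (hpf.2.2 _) a
    have h2 := sum_edges (adjacency k Λ (Fin.ofNat k n)) a
      fun q => (rhoProd k Λ (n + 1))⁻¹ * perronFrobenius k Λ q
    refine Eq.trans (Eq.trans ?_ h2) ?_
    · exact Finset.sum_congr rfl fun e _ => by congr
    rw [rhoProd_succ, mul_inv]
    calc _ = (rho k Λ (Fin.ofNat k n))⁻¹ * (rhoProd k Λ n)⁻¹ *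
        ∑ b, (adjacency k Λ (Fin.ofNat k n) a b : ℝ) * perronFrobenius k Λ b := by
          rw [Finset.mul_sum]
          exact Finset.sum_congr rfl fun b _ => by ring
      _ = _ := by
          rw [h1, vertexMass]
          rw [mul_comm (rho k Λ _)⁻¹, mul_assoc, inv_mul_cancel_left₀ (hρ _).ne']
  · change rhoProd k Λ n ^ (-(1 / δ)) * _ = _
    rw [Real.rpow_neg (hpos n).le, ← Real.inv_rpow (hpos n).le]
    rfl

end KGraph

theorem mainTheorem7 (k : ℕ) [NeZero k] (Λ : Type u) [Category.{v} Λ] [KGraph k Λ]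
    [Fintype Λ] [DecidableEq Λ] [Nonempty Λ]
    (hfin : KGraph.IsFinite k Λ) (hconn : KGraph.StronglyConnected Λ)
    (δ : ℝ) (hδ0 : 0 < δ) (hδ1 : δ < 1)
    (hdiam : BratteliDiagram.WeightEqDiam (KGraph.weight k Λ δ)) :
    ∃ m : MetricSpace (KGraph.bratteli k Λ).InfPath,
      (∀ x y, dist x y = BratteliDiagram.pathDist (KGraph.weight k Λ δ) x y) ∧
      IsUltrametricDist (KGraph.bratteli k Λ).InfPath ∧
      letI : MeasurableSpace (KGraph.bratteli k Λ).InfPath := borel _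
      haveI : BorelSpace (KGraph.bratteli k Λ).InfPath := ⟨rfl⟩
      0 < Measure.hausdorffMeasure δ (Set.univ : Set (KGraph.bratteli k Λ).InfPath) ∧
        Measure.hausdorffMeasure δ (Set.univ : Set (KGraph.bratteli k Λ).InfPath) < ⊤ := by
  have hpf := KGraph.isPerronFrobenius_perronFrobenius hfin hconn
  obtain ⟨a, -, ha⟩ := Finset.exists_min_image Finset.univ (KGraph.perronFrobenius k Λ)
    Finset.univ_nonempty
  obtain ⟨x, -⟩ := hdiam.exists_range_eq a
  have hρ := KGraph.rho_pos hpf x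
  have hM := KGraph.isMass_weight hpf hρ δ
  have ha' : ∀ n (b : (KGraph.bratteli k Λ).V n),
      KGraph.vertexMass (k := k) (Λ := Λ) 0 a ≤ KGraph.vertexMass n b :=
    fun n b => ha b (Finset.mem_univ (b : Λ))
  -- Along multiples of `k` the coefficients form a geometric sequence, so a single value below `1`
  -- forces convergence to `0`.
  have hu : Filter.Tendsto (fun q => (KGraph.rhoProd k Λ (q * k))⁻¹) Filter.atTop (nhds 0) := by
    have hk : Filter.Tendsto (fun q => q * k) Filter.atTop Filter.atTop :=
      Filter.tendsto_id.atTop_mul_const' (NeZero.pos k)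
    obtain ⟨q, hq⟩ := (hk.eventually (hM.eventually_coeff_lt_one hdiam ha')).exists
    simp only [KGraph.rhoProd_mul, ← inv_pow] at hq ⊢
    have h0 : 0 ≤ (∏ i, KGraph.rho k Λ i)⁻¹ :=
      inv_nonneg.2 (Finset.prod_nonneg fun i _ => (hρ i).le)
    exact tendsto_pow_atTop_nhds_zero_of_lt_one h0
      (not_le.1 fun h1 => hq.not_ge (one_le_pow₀ h1))
  let m := BratteliDiagram.pathMetric hM.weight_pos hM.weight_zero_le_one hdiam.antitone
  refine ⟨m, fun _ _ => rfl, ⟨BratteliDiagram.pathDist_le_max hM.weight_pos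
    hM.weight_zero_le_one hdiam.antitone⟩, ?_⟩
  let _ : MeasurableSpace (KGraph.bratteli k Λ).InfPath := borel _
  have : BorelSpace (KGraph.bratteli k Λ).InfPath := ⟨rfl⟩
  exact ⟨zero_lt_one.trans_le (hM.one_le_hausdorffMeasure hδ0 hδ1.le (fun _ _ => rfl) hdiam hu),
    hM.hausdorffMeasure_lt_top hδ0 (fun _ _ => rfl) hdiam ha' hu⟩
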